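/- **Setting.** Let $\alpha\ge 2$ and let $\Delta,h,n$ be nonnegative integers. Let $T$ be a finite rooted tree with nonnegative edge lengths that is a $\Delta$-ary $\alpha$-HST of height $h$, i.e.: every internal node has exactly $\Delta$ children; every root-to-leaf path has exactly $h$ edges; all edges from a node to its children have the same length; the edge from a non-root node to its parent is $\alpha$ times as long as each edge to its children; all edges ending in a leaf have the same length; and, as normalization, the edges at the root have length $1$. Let $\delta(u,v)$ be the length of the tree path between $u$ and $v$. Given $n$ servers located at leaves of $T$ and $n$ requests located at leaves and arriving one by one, the *Random-Subtree* algorithm $\mathrm{RS}$ matches each arriving request $r$ immediately and irrevocably as follows. Let $v$ be the lowest ancestor of $r$ (possibly $r$ itself) whose subtree contains an available (not yet matched) server. Starting from $v$, the algorithm repeatedly moves to a child chosen uniformly at random among the children of the current node whose subtrees contain an available server, until it reaches a leaf; $r$ is matched to an available server $s$ at this leaf, at cost $\delta(r,s)$. Let $\mathrm{cost}(\mathrm{RS};S,R)$ be the expected total cost for servers $S=(s_1,\dots,s_n)$ and request sequence $R=(r_1,\dots,r_n)$, and for a distribution $\mathbb D$ on $n$-tuples of leaves let $\mathrm{cost}(\mathrm{RS};\mathbb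 D,\mathbb D)=\mathbb E_{S\sim\mathbb D}\,\mathbb E_{R\sim\mathbb D}[\mathrm{cost}(\mathrm{RS};S,R)]$, where $S$ and $R$ are independent. **Theorem.** For all probability distributions $\mathbb D_1,\dots,\mathbb D_n$ on the leaves of $T$ and $\mathbb D=\prod_{i=1}^n\mathbb D_i$, $$\mathrm{cost}(\mathrm{RS};\mathbb D,\mathbb D)\;\le\;6H_\Delta\sqrt n\,\sum_{j=0}^{h-1}\left(\frac{\sqrt{\Delta^{h-j}}}{\alpha^{h-j-1}}\sum_{\ell=0}^{j}\xi^\ell\right),\qquad \xi=\frac{H_\Delta}{\alpha},\quad H_\Delta=\sum_{k=1}^{\Delta}\frac1k .$$ -/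

import Mathlib

noncomputable section

namespace HST

open Classical in
/-- The children of the node `v` of a rooted tree. The order of a `RootedTree` is the ancestor
order, `⊥` is the root, and the parent of a node `w ≠ ⊥` is `Order.pred w`. -/
def children (T : RootedTree) [Fintype T] (v : T) : Finset T :=
  Finset.univ.filter fun w => v ⋖ w

/-- A leaf is a node without descendants other than itself. -/
def IsLeaf (T : RootedTree) (v : T) : Prop := IsMax v

open Classical in
/-- The number of edges on the path from the root to `v`
(an edge is identified with its lower endpoint, which is a node different from the root). -/
def depth (T : RootedTree) [Fintype T] (v : T) : ℕ :=
  (Finset.univ.filter fun w : T => ⊥ < w ∧ w ≤ v).card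

/-- `len` makes `T` an `α`-HST. Here `len w`, for `w ≠ ⊥`, is the length of the edge between `w`
and its parent; the value `len ⊥` is never used. -/
structure IsHST (T : RootedTree) (len : T → ℝ) (α : ℝ) : Prop where
  /-- edge lengths are nonnegative -/
  nonneg : ∀ w : T, w ≠ ⊥ → 0 ≤ len w
  /-- all edges from a node to its children have the same length -/
  siblings : ∀ v u w : T, v ⋖ u → v ⋖ w → len u = len w
  /-- the edge to the parent is `α` times as long as an edge to a child -/
  scale : ∀ v w : T, v ≠ ⊥ → v ⋖ w → len v = α * len w
  /-- all edges that end in a leaf have the same length -/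
  leaves : ∀ u w : T, u ≠ ⊥ → w ≠ ⊥ → IsLeaf T u → IsLeaf T w → len u = len w

/-- The edges at the root have length `1`. -/
def IsNormalized (T : RootedTree) (len : T → ℝ) : Prop :=
  ∀ w : T, ⊥ ⋖ w → len w = 1

/-- Every internal node has exactly `Δ` children. -/
def IsAry (T : RootedTree) [Fintype T] (Δ : ℕ) : Prop :=
  ∀ v : T, ¬ IsLeaf T v → (children T v).card = Δ

/-- Every path from the root to a leaf has exactly `h` edges. -/
def HasHeight (T : RootedTree) [Fintype T] (h : ℕ) : Prop :=
  ∀ v : T, IsLeaf T v → depth T v = h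

open Classical in
/-- The length of the unique tree path between `u` and `v`: it goes from `u` up to the lowest
common ancestor `u ⊓ v` and from there down to `v`. -/
def treeDist (T : RootedTree) [Fintype T] (len : T → ℝ) (u v : T) : ℝ :=
  (∑ w ∈ Finset.univ.filter (fun w : T => u ⊓ v < w ∧ w ≤ u), len w) +
    ∑ w ∈ Finset.univ.filter (fun w : T => u ⊓ v < w ∧ w ≤ v), len w

/-! ### The Random-Subtree algorithm

The state of the algorithm is the multiset `A` of the locations of the available servers
(servers at the same location are interchangeable). -/

/-- The subtree rooted at `v` contains an available server. -/
def Live (T : RootedTree) (A : Multiset T) (v : T) : Prop := ∃ s ∈ A, v ≤ s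

open Classical in
/-- The children of `v` whose subtrees contain an available server. -/
def liveChildren (T : RootedTree) [Fintype T] (A : Multiset T) (v : T) : Finset T :=
  (children T v).filter fun w => Live T A w

open Classical in
theorem lt_of_mem_liveChildren {T : RootedTree} [Fintype T] {A : Multiset T} {v w : T}
    (hw : w ∈ liveChildren T A v) : v < w := by
  have h := (Finset.mem_filter.1 hw).1
  exact (Finset.mem_filter.1 h).2.lt

open Classical in
/-- The random descent from `v`: move to a uniformly random child whose subtree contains an
available server, and repeat until there is no such child, that is, until a leaf is reached. -/
def descend (T : RootedTree) [Fintype T] (A : Multiset T) (v : T) : PMF T :=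
  if hv : (liveChildren T A v).Nonempty then
    (PMF.uniformOfFinset (liveChildren T A v) hv).bindOnSupport fun w _ => descend T A w
  else PMF.pure v
termination_by (Finset.univ.filter fun w : T => v < w).card
decreasing_by
  rename_i hw
  have hlt : v < w := lt_of_mem_liveChildren ((PMF.mem_support_uniformOfFinset_iff hv w).1 hw)
  apply Finset.card_lt_card
  rw [Finset.ssubset_iff_of_subset]
  · exact ⟨w, by simpa using hlt, by simp⟩
  · intro x hx
    simp only [Finset.mem_filter, Finset.mem_univ, true_and] at hx ⊢
    exact hlt.trans hx

open Classical in
/-- The law of the location of the server to which a request at `r` is matched: descend from the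
lowest ancestor of `r` (possibly `r` itself) whose subtree contains an available server. Such an
ancestor exists as soon as there is an available server; the other case is never reached. -/
def rsMatch (T : RootedTree) [Fintype T] (A : Multiset T) (r : T) : PMF T :=
  if hr : ∃ v, IsGreatest {v : T | v ≤ r ∧ Live T A v} v then descend T A hr.choose
  else PMF.pure r

open Classical in
/-- The law of the sequence of the locations of the servers to which the requests
`R 0, R 1, …, R (n - 1)`, arriving in this order, are matched, when `A` is the multiset of the
locations of the servers that are available at the beginning. -/
def rsRun (T : RootedTree) [Fintype T] : (n : ℕ) → Multiset T → (Fin n → T) → PMF (Fin n → T)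
  | 0, _, _ => PMF.pure Fin.elim0
  | n + 1, A, R => (rsMatch T A (R 0)).bind fun s =>
      (rsRun T n (A.erase s) (Fin.tail R)).map fun M => Fin.cons s M

open Classical in
/-- `cost(RS; S, R)`: the expected total cost of the Random-Subtree algorithm for servers at
`S 0, …, S (n - 1)` and the request sequence `R`. -/
def rsCost (T : RootedTree) [Fintype T] (len : T → ℝ) {n : ℕ} (S R : Fin n → T) : ℝ :=
  ∑ M : Fin n → T, (rsRun T n (Finset.univ.val.map S) R M).toReal *
    ∑ t, treeDist T len (R t) (M t)

open Classical in
/-- The expectation of `f` under the product distribution `∏ i, D i` on `Fin n → T`. -/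
def prodExpect (T : RootedTree) [Fintype T] {n : ℕ} (D : Fin n → PMF T)
    (f : (Fin n → T) → ℝ) : ℝ :=
  ∑ x : Fin n → T, (∏ i, (D i (x i)).toReal) * f x

/-- `cost(RS; 𝔻, 𝔻)` for `𝔻 = ∏ i, D i`: the server locations and the request sequence are drawn
independently of each other, both from `𝔻`. -/
def rsExpectedCost (T : RootedTree) [Fintype T] (len : T → ℝ) {n : ℕ} (D : Fin n → PMF T) : ℝ :=
  prodExpect T D fun S => prodExpect T D fun R => rsCost T len S R

end HST

end

/-!
The cost of a matched pair is a weighted count of crossings: level `j` (the nodes at depth `h - j`) is crossed when the request and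
its server have different `j`-th ancestors, and a crossing costs `2 / α ^ (h - j - 1)`
(`treeDist_le`).

The expected numbers `a j` of crossings satisfy `a j ≤ H_Δ (x j + a (j + 1))`, where `x j` is the
expected total imbalance between requests and servers over the nodes of level `j`. The proof uses
a potential that depends on the available servers and the future requests, seen from level `j`
only. In the process where every request is either served inside its own node of level `j` or
dropped, each dropped request pays `H_m`, where `m` is the number of siblings of its node that are
still alive. The point is that taking a server from one of `m` live siblings, chosen uniformly,
increases this potential by at most `H_m - 1` on average (`sum_potential_erase_le`). So a request
that crosses level `j` but not level `j + 1` is paid for by the potential it releases, and a request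
that crosses level `j + 1` as well costs at most `H_Δ` (`expect_rsMatch_le`). The initial
potential is at most `H_Δ` times the number of requests in excess of the servers, node by node
(`potential_le`). No request crosses the level of the root, so `a h ≤ 0`.

For independent servers and requests with the same law, the imbalance of a node has mean zero and
its second moment is at most twice the expected number of servers in the node
(`prodExpect_sub_sq_le`). As there are at most `Δ ^ (h - j)` nodes on the level, this gives
`x j ≤ (3 / 2) √n √(Δ ^ (h - j))` (`expect_imbalance_le`). Solving the recursion
(`sum_div_pow_le`) yields the theorem, even with the constant `3`.
-/

namespace HST

open Finset

/-! ### Ancestors, depths and edge lengths -/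

section Tree

variable {T : RootedTree}

/-- The `j`-th ancestor of `v`; the root is its own parent. -/
def up (j : ℕ) (v : T) : T := Order.pred^[j] v

@[simp] lemma up_zero (v : T) : up 0 v = v := rfl

lemma up_succ (j : ℕ) (v : T) : up (j + 1) v = Order.pred (up j v) :=
  Function.iterate_succ_apply' _ _ _

lemma up_le (j : ℕ) (v : T) : up j v ≤ v := Order.pred_iterate_le _ _

lemma up_antitone (v : T) : Antitone fun j => up j v := by
  refine antitone_nat_of_succ_le fun j => ?_
  rw [up_succ]
  exact Order.pred_le _

lemma exists_up_eq {w v : T} (h : w ≤ v) : ∃ j, up j v = w := h.exists_pred_iterate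

lemma covBy_iff_pred_eq {v w : T} : v ⋖ w ↔ w ≠ ⊥ ∧ Order.pred w = v := by
  constructor
  · intro h
    exact ⟨h.lt.ne_bot, h.pred_eq⟩
  · rintro ⟨h, rfl⟩
    exact Order.pred_covBy_of_not_isMin (by simpa using h)

open Classical in
/-- The indicator of the event that the path between the leaves `r` and `s` uses the edges
`j` levels above the leaves. -/
noncomputable def cross (j : ℕ) (r s : T) : ℝ := if up j r = up j s then 0 else 1

lemma cross_nonneg (j : ℕ) (r s : T) : 0 ≤ cross j r s := by
  rw [cross]
  split_ifs <;> norm_num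

lemma cross_le_one (j : ℕ) (r s : T) : cross j r s ≤ 1 := by
  rw [cross]
  split_ifs <;> norm_num

lemma cross_comm (j : ℕ) (r s : T) : cross j r s = cross j s r := by
  classical
  by_cases h : up j r = up j s
  · simp [cross, h]
  · simp [cross, h, Ne.symm h]

variable [Fintype T]

@[simp] lemma depth_bot : depth T ⊥ = 0 := by
  classical
  rw [depth, Finset.card_eq_zero, Finset.filter_eq_empty_iff]
  rintro x - ⟨h, h'⟩
  exact absurd h' (not_le_of_gt h)

lemma depth_pred_add_one {v : T} (hv : v ≠ ⊥) : depth T (Order.pred v) + 1 = depth T v := by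
  classical
  have hlt : Order.pred v < v := Order.pred_lt_of_not_isMin (by simpa using hv)
  rw [depth, depth, ← Finset.card_insert_of_notMem (a := v)]
  · congr 1
    ext w
    simp only [mem_insert, mem_filter, mem_univ, true_and]
    constructor
    · rintro (rfl | ⟨h, h'⟩)
      · exact ⟨bot_lt_iff_ne_bot.2 hv, le_rfl⟩
      · exact ⟨h, h'.trans hlt.le⟩
    · rintro ⟨h, h'⟩
      rcases h'.eq_or_lt with rfl | h'
      · exact Or.inl rfl
      · exact Or.inr ⟨h, Order.le_pred_of_lt h'⟩
  · simp only [mem_filter, mem_univ, true_and, not_and]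
    exact fun _ h => absurd h (not_le_of_gt hlt)

lemma depth_eq_zero {v : T} : depth T v = 0 ↔ v = ⊥ := by
  constructor
  · intro h
    by_contra hv
    have := depth_pred_add_one hv
    lia
  · rintro rfl
    exact depth_bot

lemma depth_up (j : ℕ) (v : T) : depth T (up j v) = depth T v - j := by
  induction j with
  | zero => simp
  | succ j ih =>
    rw [up_succ]
    by_cases h : up j v = ⊥
    · have := depth_eq_zero.2 h
      rw [h, Order.pred_bot, depth_bot]
      lia
    · have := depth_pred_add_one h
      lia

lemma up_eq_bot {j : ℕ} {v : T} : up j v = ⊥ ↔ depth T v ≤ j := by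
  rw [← depth_eq_zero, depth_up]
  lia

lemma depth_covBy {v w : T} (h : v ⋖ w) : depth T w = depth T v + 1 := by
  obtain ⟨hw, rfl⟩ := covBy_iff_pred_eq.1 h
  exact (depth_pred_add_one hw).symm

lemma up_depth_sub {w v : T} (h : w ≤ v) : up (depth T v - depth T w) v = w := by
  obtain ⟨j, rfl⟩ := exists_up_eq h
  rw [depth_up]
  rcases le_total j (depth T v) with hj | hj
  · congr 1
    lia
  · rw [up_eq_bot.2 hj, up_eq_bot]
    lia

lemma up_eq_of_le {j : ℕ} {w v : T} (h : w ≤ v) (hj : depth T v = depth T w + j) :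
    up j v = w := by
  conv_rhs => rw [← up_depth_sub h]
  congr 1
  lia

lemma depth_mono {w v : T} (h : w ≤ v) : depth T w ≤ depth T v := by
  obtain ⟨j, rfl⟩ := exists_up_eq h
  rw [depth_up]
  lia

open Classical in
/-- The nodes at depth `k`. -/
noncomputable def level (T : RootedTree) [Fintype T] (k : ℕ) : Finset T :=
  univ.filter fun v => depth T v = k

lemma mem_level {k : ℕ} {v : T} : v ∈ level T k ↔ depth T v = k := by simp [level]

lemma card_children_le {Δ : ℕ} (hary : IsAry T Δ) (v : T) : (children T v).card ≤ Δ := by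
  classical
  by_cases hv : IsLeaf T v
  · have : children T v = ∅ := by
      refine Finset.filter_eq_empty_iff.2 fun w _ hw => ?_
      exact absurd (hv hw.le) (not_le_of_gt hw.lt)
    simp [this]
  · exact (hary v hv).le

lemma card_level_le {Δ : ℕ} (hary : IsAry T Δ) (k : ℕ) : (level T k).card ≤ Δ ^ k := by
  classical
  induction k with
  | zero =>
    rw [pow_zero]
    refine Finset.card_le_one.2 fun a ha b hb => ?_
    rw [mem_level, depth_eq_zero] at ha hb
    rw [ha, hb]
  | succ k ih =>
    have hsub : level T (k + 1) ⊆ (level T k).biUnion (children T) := by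
      intro w hw
      rw [mem_level] at hw
      have hne : w ≠ ⊥ := by
        rintro rfl
        simp at hw
      refine mem_biUnion.2 ⟨Order.pred w, mem_level.2 ?_, ?_⟩
      · have := depth_pred_add_one hne
        lia
      · exact Finset.mem_filter.2 ⟨mem_univ _, covBy_iff_pred_eq.2 ⟨hne, rfl⟩⟩
    refine (card_le_card hsub).trans (card_biUnion_le.trans ?_)
    refine (sum_le_card_nsmul _ _ Δ fun v _ => card_children_le hary v).trans ?_
    rw [smul_eq_mul, pow_succ]
    exact Nat.mul_le_mul_right _ ih

lemma len_eq {len : T → ℝ} {α : ℝ} (hα : 0 < α) (hT : IsHST T len α)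
    (hnorm : IsNormalized T len) (k : ℕ) {w : T} (hw : depth T w = k + 1) :
    len w = 1 / α ^ k := by
  induction k generalizing w with
  | zero =>
    rw [pow_zero, div_one]
    have hne : w ≠ ⊥ := by
      rintro rfl
      simp at hw
    refine hnorm w (covBy_iff_pred_eq.2 ⟨hne, ?_⟩)
    have := depth_pred_add_one hne
    exact depth_eq_zero.1 (by lia)
  | succ k ih =>
    have hne : w ≠ ⊥ := by
      rintro rfl
      simp at hw
    have hd := depth_pred_add_one hne
    have hp : Order.pred w ≠ ⊥ := by
      intro h
      rw [h, depth_bot] at hd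
      lia
    have h1 := hT.scale _ _ hp (covBy_iff_pred_eq.2 ⟨hne, rfl⟩)
    rw [ih (by lia)] at h1
    rw [pow_succ, ← div_div, h1]
    field_simp

lemma sum_len_path_le {len : T → ℝ} {α : ℝ} {h : ℕ} (hα : 0 < α) (hT : IsHST T len α)
    (hnorm : IsNormalized T len) {r s : T} (hr : depth T r = h) (S : Finset T)
    (hS : ∀ w ∈ S, w ≤ r ∧ ¬ w ≤ s) :
    ∑ w ∈ S, len w ≤ ∑ j ∈ range h, 1 / α ^ (h - j - 1) * cross j r s := by
  classical
  have hsub : S ⊆ ((range h).filter fun j => up j r ≠ up j s).image fun j => up j r := by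
    intro w hw
    obtain ⟨hwr, hws⟩ := hS w hw
    have hj := up_depth_sub hwr
    have hne : w ≠ ⊥ := by
      rintro rfl
      exact hws bot_le
    have hd : depth T w ≠ 0 := fun h0 => hne (depth_eq_zero.1 h0)
    have := depth_mono hwr
    refine mem_image.2 ⟨_, mem_filter.2 ⟨mem_range.2 ?_, ?_⟩, hj⟩
    · lia
    · intro he
      rw [hj] at he
      exact hws (he ▸ up_le _ _)
  have hlen : ∀ j ∈ range h, len (up j r) = 1 / α ^ (h - j - 1) := by
    intro j hj
    refine len_eq hα hT hnorm _ ?_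
    rw [depth_up]
    have := mem_range.1 hj
    lia
  calc ∑ w ∈ S, len w
      ≤ ∑ w ∈ ((range h).filter fun j => up j r ≠ up j s).image fun j => up j r, len w := by
        refine sum_le_sum_of_subset_of_nonneg hsub fun w hw _ => ?_
        obtain ⟨j, hj, rfl⟩ := mem_image.1 hw
        rw [hlen j (mem_filter.1 hj).1]
        positivity
    _ = ∑ j ∈ (range h).filter fun j => up j r ≠ up j s, len (up j r) := by
        refine sum_image fun i hi j hj hij => ?_
        have hi' := mem_range.1 (mem_filter.1 hi).1
        have hj' := mem_range.1 (mem_filter.1 hj).1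
        have := congrArg (depth T) hij
        rw [depth_up, depth_up] at this
        lia
    _ = ∑ j ∈ range h, 1 / α ^ (h - j - 1) * cross j r s := by
        rw [sum_filter]
        refine sum_congr rfl fun j hj => ?_
        rw [hlen j hj, cross]
        split_ifs <;> simp_all

lemma treeDist_le {len : T → ℝ} {α : ℝ} {h : ℕ} (hα : 0 < α) (hT : IsHST T len α)
    (hnorm : IsNormalized T len) {r s : T} (hr : depth T r = h) (hs : depth T s = h) :
    treeDist T len r s ≤ 2 * ∑ j ∈ range h, 1 / α ^ (h - j - 1) * cross j r s := by
  classical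
  rw [treeDist, two_mul]
  refine add_le_add (sum_len_path_le hα hT hnorm hr _ fun w hw => ?_) ?_
  · obtain ⟨h1, h2⟩ := (mem_filter.1 hw).2
    exact ⟨h2, fun h3 => absurd (le_inf h2 h3) (not_le_of_gt h1)⟩
  · simp only [cross_comm _ r s]
    refine sum_len_path_le hα hT hnorm hs _ fun w hw => ?_
    obtain ⟨h1, h2⟩ := (mem_filter.1 hw).2
    exact ⟨h2, fun h3 => absurd (le_inf h3 h2) (not_le_of_gt h1)⟩

end Tree

/-! ### The potential of one level -/

section Potential

variable {ι : Type*} [DecidableEq ι] (p : ι → ι)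

/-- The elements of `B` whose parent is `v`. -/
noncomputable def liveOver (B : Multiset ι) (v : ι) : Finset ι :=
  B.toFinset.filter fun w => p w = v

lemma mem_liveOver {B : Multiset ι} {v w : ι} : w ∈ liveOver p B v ↔ w ∈ B ∧ p w = v := by
  simp [liveOver]

/-- The potential of one level of the tree. `B` is the multiset of the nodes of that level above
the available servers, and the list holds the nodes above the future requests. Requests are served
inside their own node as long as that is possible; every other request pays `H_m`, where `m` is
the number of siblings with an available server, and leaves `B` unchanged. -/
noncomputable def potential : Multiset ι → List ι → ℝ
  | _, [] => 0
  | B, w :: l =>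
    if w ∈ B then potential (B.erase w) l
    else (harmonic (liveOver p B (p w)).card : ℝ) + potential B l

lemma harmonic_mono : Monotone fun n => (harmonic n : ℝ) := by
  refine monotone_nat_of_le_succ fun n => ?_
  rw [harmonic_succ]
  push_cast
  have : (0 : ℝ) ≤ ((n : ℝ) + 1)⁻¹ := by positivity
  linarith

lemma harmonic_nonneg (n : ℕ) : (0 : ℝ) ≤ harmonic n := by
  have := harmonic_mono (Nat.zero_le n)
  simpa using this

lemma sum_range_harmonic (m : ℕ) :
    ∑ i ∈ range m, (harmonic i : ℝ) = m * ((harmonic m : ℝ) - 1) := by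
  induction m with
  | zero => simp
  | succ m ih =>
    rw [sum_range_succ, ih, harmonic_succ]
    push_cast
    have : (m : ℝ) + 1 ≠ 0 := by positivity
    field_simp
    ring

lemma liveOver_erase_subset (B : Multiset ι) (v w : ι) :
    liveOver p (B.erase w) v ⊆ liveOver p B v := by
  intro x hx
  rw [mem_liveOver] at hx ⊢
  exact ⟨Multiset.mem_of_mem_erase hx.1, hx.2⟩

/-- Removing a uniformly random one of the `m` live children of `v` raises the potential by at
most `H_m - 1` on average, since `∑ i < m, H_i = m (H_m - 1)` (`sum_range_harmonic`). If the first request empties a child `w` of `v`, then removing `w`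
beforehand turns this request into one that pays `H_{m-1}`, while the other children see `m - 1`
live siblings from then on. -/
lemma sum_potential_erase_le (B : Multiset ι) (l : List ι) (v : ι) :
    ∑ w ∈ liveOver p B v, (potential p (B.erase w) l - potential p B l) ≤
      ∑ i ∈ range (liveOver p B v).card, (harmonic i : ℝ) := by
  induction l generalizing B with
  | nil =>
    simp only [potential, sub_self, sum_const_zero]
    exact sum_nonneg fun i _ => harmonic_nonneg i
  | cons u l ih =>
    by_cases hu : u ∈ B
    · -- a removal of a server from another node commutes with the first request
      have hcomm : ∀ w ∈ liveOver p B v, w ≠ u →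
          potential p (B.erase w) (u :: l) - potential p B (u :: l) =
            potential p ((B.erase u).erase w) l - potential p (B.erase u) l := by
        intro w _ hwu
        rw [potential, potential, if_pos hu,
          if_pos ((Multiset.mem_erase_of_ne hwu.symm).2 hu), Multiset.erase_comm]
      by_cases hu2 : u ∈ B.erase u
      · have hlive : liveOver p (B.erase u) v = liveOver p B v := by
          refine subset_antisymm (liveOver_erase_subset p B v u) fun x hx => ?_
          rw [mem_liveOver] at hx ⊢
          refine ⟨?_, hx.2⟩
          by_cases hxu : x = u
          · exact hxu ▸ hu2
          · exact (Multiset.mem_erase_of_ne hxu).2 hx.1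
        rw [← hlive]
        refine le_trans (le_of_eq ?_) (ih (B.erase u))
        refine sum_congr rfl fun w hw => ?_
        by_cases hwu : w = u
        · subst hwu
          rw [potential, potential, if_pos hu, if_pos hu2]
        · exact hcomm w (hlive ▸ hw) hwu
      · have hlive : liveOver p (B.erase u) v = (liveOver p B v).erase u := by
          ext x
          rw [mem_erase, mem_liveOver, mem_liveOver]
          by_cases hxu : x = u
          · subst hxu
            simp [hu2]
          · rw [Multiset.mem_erase_of_ne hxu]
            simp [hxu]
        by_cases huv : u ∈ liveOver p B v
        · have hpu := (mem_liveOver p).1 huv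
          rw [← add_sum_erase _ _ huv, ← card_erase_add_one huv, sum_range_succ, add_comm]
          refine add_le_add ?_ ?_
          · rw [← hlive]
            refine le_trans (le_of_eq ?_) (ih (B.erase u))
            refine sum_congr rfl fun w hw => ?_
            rw [hlive] at hw
            exact hcomm w (mem_of_mem_erase hw) (ne_of_mem_erase hw)
          · rw [potential, potential, if_pos hu, if_neg hu2, hpu.2, hlive]
            simp
        · have hE : (liveOver p B v).erase u = liveOver p B v := erase_eq_of_notMem huv
          rw [hE] at hlive
          rw [← hlive]
          refine le_trans (le_of_eq ?_) (ih (B.erase u))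
          refine sum_congr rfl fun w hw => ?_
          rw [hlive] at hw
          exact hcomm w hw fun h => huv (h ▸ hw)
    · refine le_trans (sum_le_sum fun w _ => ?_) (ih B)
      rw [potential, potential, if_neg hu, if_neg fun h => hu (Multiset.mem_of_mem_erase h)]
      have := harmonic_mono (card_le_card (liveOver_erase_subset p B (p u) w))
      simp only at this
      linarith

/-- Only requests in excess of the servers of their node pay. -/
lemma potential_le {Δ : ℕ} (N : Finset ι) (l : List ι) (hl : ∀ w ∈ l, w ∈ N)
    (B : Multiset ι) (hΔ : ∀ v, (liveOver p B v).card ≤ Δ) :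
    potential p B l ≤
      harmonic Δ * ∑ w ∈ N, ((l.count w - B.count w : ℕ) : ℝ) := by
  induction l generalizing B with
  | nil => simp [potential]
  | cons u l ih =>
    have hl' : ∀ w ∈ l, w ∈ N := fun w hw => hl w (List.mem_cons_of_mem _ hw)
    rw [potential]
    split_ifs with hu
    · refine (ih hl' _ fun v => (card_le_card (liveOver_erase_subset p B v u)).trans (hΔ v)).trans
        (le_of_eq ?_)
      congr 1
      refine sum_congr rfl fun w _ => ?_
      congr 1
      by_cases hwu : w = u
      · subst hwu
        rw [List.count_cons_self, Multiset.count_erase_self]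
        have := Multiset.count_pos.2 hu
        lia
      · rw [List.count_cons_of_ne (Ne.symm hwu), Multiset.count_erase_of_ne hwu]
    · have huN := hl u List.mem_cons_self
      rw [← add_sum_erase _ _ huN, Multiset.count_eq_zero_of_notMem hu, List.count_cons_self]
      have h1 := ih hl' B hΔ
      rw [← add_sum_erase _ _ huN, Multiset.count_eq_zero_of_notMem hu] at h1
      have h2 : ∑ w ∈ N.erase u, (((u :: l).count w - B.count w : ℕ) : ℝ) =
          ∑ w ∈ N.erase u, ((l.count w - B.count w : ℕ) : ℝ) := by
        refine sum_congr rfl fun w hw => ?_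
        rw [List.count_cons_of_ne (Ne.symm (ne_of_mem_erase hw))]
      rw [h2]
      have h3 := harmonic_mono (hΔ (p u))
      simp only [Nat.sub_zero] at h1 h3 ⊢
      push_cast
      linarith

end Potential

/-! ### Expectations over finite types -/

section Expect

variable {X Y : Type*} [Fintype X] [Fintype Y]

/-- The expectation of `f` under `q`. -/
noncomputable def expect (q : PMF X) (f : X → ℝ) : ℝ := ∑ x, (q x).toReal * f x

lemma sum_toReal (q : PMF X) : ∑ x, (q x).toReal = 1 := by
  have h := q.tsum_coe
  rw [tsum_fintype] at h
  rw [← ENNReal.toReal_sum fun x _ => q.apply_ne_top x, h, ENNReal.toReal_one]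

lemma expect_const (q : PMF X) (c : ℝ) : expect q (fun _ => c) = c := by
  rw [expect, ← sum_mul, sum_toReal, one_mul]

lemma expect_add (q : PMF X) (f g : X → ℝ) :
    expect q (fun x => f x + g x) = expect q f + expect q g := by
  simp only [expect, mul_add, sum_add_distrib]

lemma expect_const_mul (q : PMF X) (c : ℝ) (f : X → ℝ) :
    expect q (fun x => c * f x) = c * expect q f := by
  simp only [expect, mul_sum, mul_left_comm]

lemma expect_sum {I : Type*} (q : PMF X) (s : Finset I) (f : I → X → ℝ) :
    expect q (fun x => ∑ i ∈ s, f i x) = ∑ i ∈ s, expect q (f i) := by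
  simp only [expect, mul_sum]
  exact sum_comm

lemma expect_mono {q : PMF X} {f g : X → ℝ} (h : ∀ x ∈ q.support, f x ≤ g x) :
    expect q f ≤ expect q g := by
  refine sum_le_sum fun x _ => ?_
  by_cases hx : x ∈ q.support
  · exact mul_le_mul_of_nonneg_left (h x hx) ENNReal.toReal_nonneg
  · simp [(q.apply_eq_zero_iff x).2 hx]

lemma expect_congr {q : PMF X} {f g : X → ℝ} (h : ∀ x ∈ q.support, f x = g x) :
    expect q f = expect q g :=
  le_antisymm (expect_mono fun x hx => (h x hx).le) (expect_mono fun x hx => (h x hx).ge)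

lemma expect_nonneg {q : PMF X} {f : X → ℝ} (h : ∀ x, 0 ≤ f x) : 0 ≤ expect q f :=
  sum_nonneg fun x _ => mul_nonneg ENNReal.toReal_nonneg (h x)

lemma expect_pure (a : X) (f : X → ℝ) : expect (PMF.pure a) f = f a := by
  classical
  rw [expect, sum_eq_single a]
  · simp
  · intro b _ hb
    simp [hb]
  · simp

lemma expect_bind (q : PMF X) (k : X → PMF Y) (f : Y → ℝ) :
    expect (q.bind k) f = expect q fun x => expect (k x) f := by
  simp only [expect, PMF.bind_apply, tsum_fintype, mul_sum]
  rw [sum_comm]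
  refine sum_congr rfl fun y _ => ?_
  rw [ENNReal.toReal_sum fun x _ => ENNReal.mul_ne_top (q.apply_ne_top x) ((k x).apply_ne_top y),
    sum_mul]
  refine sum_congr rfl fun x _ => ?_
  rw [ENNReal.toReal_mul, mul_assoc]

lemma expect_map (q : PMF X) (k : X → Y) (f : Y → ℝ) :
    expect (q.map k) f = expect q fun x => f (k x) := by
  rw [← PMF.bind_pure_comp, expect_bind]
  simp only [Function.comp_apply, expect_pure]

lemma expect_uniformOfFinset (s : Finset X) (hs : s.Nonempty) (f : X → ℝ) :
    expect (PMF.uniformOfFinset s hs) f = (∑ x ∈ s, f x) / s.card := by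
  classical
  rw [expect, sum_div, ← sum_filter_add_sum_filter_not univ (· ∈ s)]
  rw [sum_eq_zero (s := univ.filter (· ∉ s)), add_zero]
  · rw [filter_mem_eq_inter, univ_inter]
    refine sum_congr rfl fun x hx => ?_
    rw [PMF.uniformOfFinset_apply_of_mem hs hx, ENNReal.toReal_inv, ENNReal.toReal_natCast]
    field_simp
  · intro x hx
    rw [PMF.uniformOfFinset_apply_of_notMem hs (mem_filter.1 hx).2]
    simp

end Expect

/-! ### The random descent -/

section Descent

variable {T : RootedTree} [Fintype T]

lemma descend_eq_bind {A : Multiset T} {v : T} (hv : (liveChildren T A v).Nonempty) :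
    descend T A v = (PMF.uniformOfFinset (liveChildren T A v) hv).bind (descend T A) := by
  rw [descend, dif_pos hv, PMF.bindOnSupport_eq_bind]

lemma descend_eq_pure {A : Multiset T} {v : T} (hv : ¬ (liveChildren T A v).Nonempty) :
    descend T A v = PMF.pure v := by
  rw [descend, dif_neg hv]

lemma mem_liveChildren {A : Multiset T} {v w : T} :
    w ∈ liveChildren T A v ↔ v ⋖ w ∧ Live T A w := by
  simp [liveChildren, children]

lemma exists_covBy_of_lt {v s : T} (h : v < s) : ∃ w, v ⋖ w ∧ w ≤ s := by
  have h1 := up_depth_sub h.le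
  have hd : depth T s - depth T v ≠ 0 := by
    intro h0
    rw [h0, up_zero] at h1
    exact h.ne h1.symm
  refine ⟨up (depth T s - depth T v - 1) s, covBy_iff_pred_eq.2 ⟨?_, ?_⟩, up_le _ _⟩
  · rw [Ne, up_eq_bot]
    lia
  · rw [← up_succ, Nat.sub_add_cancel (Nat.pos_of_ne_zero hd), h1]

lemma liveChildren_nonempty {A : Multiset T} {v s : T} (hs : s ∈ A) (h : v < s) :
    (liveChildren T A v).Nonempty := by
  obtain ⟨w, hw, hws⟩ := exists_covBy_of_lt h
  exact ⟨w, mem_liveChildren.2 ⟨hw, s, hs, hws⟩⟩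

lemma mem_of_mem_support_descend {A : Multiset T} {v s : T} (hv : Live T A v)
    (hs : s ∈ (descend T A v).support) : v ≤ s ∧ s ∈ A := by
  induction v using WellFoundedGT.induction with
  | ind v ih =>
    by_cases hne : (liveChildren T A v).Nonempty
    · rw [descend_eq_bind hne, PMF.mem_support_bind_iff] at hs
      obtain ⟨w, hw, hs⟩ := hs
      rw [PMF.mem_support_uniformOfFinset_iff, mem_liveChildren] at hw
      obtain ⟨h1, h2⟩ := ih w hw.1.lt hw.2 hs
      exact ⟨hw.1.le.trans h1, h2⟩
    · rw [descend_eq_pure hne, PMF.mem_support_pure_iff] at hs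
      subst hs
      obtain ⟨a, ha, hva⟩ := hv
      rcases hva.eq_or_lt with rfl | hlt
      · exact ⟨le_rfl, ha⟩
      · exact absurd (liveChildren_nonempty ha hlt) hne

variable {A : Multiset T} {h j : ℕ}

lemma live_iff (hA : ∀ s ∈ A, depth T s = h) {w : T} (hw : depth T w + j = h) :
    Live T A w ↔ w ∈ A.map (up j) := by
  rw [Multiset.mem_map]
  refine exists_congr fun s => and_congr_right fun hs => ⟨fun hle => ?_, ?_⟩
  · exact up_eq_of_le hle (by rw [hA s hs, hw])
  · rintro rfl
    exact up_le _ _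

open Classical in
lemma liveChildren_eq (hA : ∀ s ∈ A, depth T s = h) {v : T} (hv : depth T v + (j + 1) = h) :
    liveChildren T A v = liveOver Order.pred (A.map (up j)) v := by
  ext w
  rw [mem_liveChildren, mem_liveOver]
  constructor
  · rintro ⟨h1, h2⟩
    refine ⟨(live_iff hA ?_).1 h2, h1.pred_eq⟩
    rw [depth_covBy h1]
    lia
  · rintro ⟨h1, rfl⟩
    obtain ⟨s, hs, rfl⟩ := Multiset.mem_map.1 h1
    refine ⟨covBy_iff_pred_eq.2 ⟨?_, rfl⟩, s, hs, up_le _ _⟩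
    rw [Ne, up_eq_bot, hA s hs]
    lia

open Classical in
/-- From a node whose children lie on level `j`, the descent passes through a uniformly random
live child. -/
lemma expect_descend_eq (hA : ∀ s ∈ A, depth T s = h) {v : T} (hv : depth T v + (j + 1) = h)
    (hlive : Live T A v) (F : T → ℝ) :
    expect (descend T A v) (fun s => F (up j s)) =
      (∑ w ∈ liveOver Order.pred (A.map (up j)) v, F w) /
        (liveOver Order.pred (A.map (up j)) v).card := by
  obtain ⟨a, ha, hva⟩ := hlive
  have hlt : v < a := hva.lt_of_ne fun he => by
    have := hA a ha
    rw [← he] at this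
    lia
  have hne := liveChildren_nonempty ha hlt
  rw [descend_eq_bind hne, expect_bind, ← liveChildren_eq hA hv, ← expect_uniformOfFinset _ hne]
  refine expect_congr fun w hw => ?_
  rw [PMF.mem_support_uniformOfFinset_iff, mem_liveChildren] at hw
  have hdw := depth_covBy hw.1
  rw [← expect_const (descend T A w) (F w)]
  refine expect_congr fun s hs => ?_
  obtain ⟨h1, h2⟩ := mem_of_mem_support_descend hw.2 hs
  rw [up_eq_of_le h1 (by rw [hA s h2]; lia)]

open Classical in
/-- Wherever the descent starts above level `j`, the last step before that level chooses uniformly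
among the live children of some node. -/
lemma expect_descend_le (hA : ∀ s ∈ A, depth T s = h) {v : T} (hv : depth T v + (j + 1) ≤ h)
    (hlive : Live T A v) (F : T → ℝ) (C : ℝ)
    (hC : ∀ v, depth T v + (j + 1) = h → Live T A v →
      (∑ w ∈ liveOver Order.pred (A.map (up j)) v, F w) /
        (liveOver Order.pred (A.map (up j)) v).card ≤ C) :
    expect (descend T A v) (fun s => F (up j s)) ≤ C := by
  induction v using WellFoundedGT.induction with
  | ind v ih =>
    rcases hv.eq_or_lt with hv | hv
    · rw [expect_descend_eq hA hv hlive]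
      exact hC v hv hlive
    · obtain ⟨a, ha, hva⟩ := hlive
      have hlt : v < a := hva.lt_of_ne fun he => by
        have := hA a ha
        rw [← he] at this
        lia
      have hne := liveChildren_nonempty ha hlt
      rw [descend_eq_bind hne, expect_bind, ← expect_const (PMF.uniformOfFinset _ hne) C]
      refine expect_mono fun w hw => ?_
      rw [PMF.mem_support_uniformOfFinset_iff, mem_liveChildren] at hw
      have hdw := depth_covBy hw.1
      exact ih w hw.1.lt (by lia) hw.2

end Descent

/-! ### One request -/

section Match

variable {T : RootedTree} [Fintype T]

open Classical in
lemma card_liveOver_le {Δ : ℕ} (hary : IsAry T Δ) {B : Multiset T} (hB : ⊥ ∉ B) (v : T) :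
    (liveOver Order.pred B v).card ≤ Δ := by
  refine (card_le_card fun w hw => ?_).trans (card_children_le hary v)
  rw [mem_liveOver] at hw
  exact Finset.mem_filter.2 ⟨mem_univ _, covBy_iff_pred_eq.2 ⟨fun h => hB (h ▸ hw.1), hw.2⟩⟩

lemma bot_notMem_map_up {A : Multiset T} {h j : ℕ} (hA : ∀ s ∈ A, depth T s = h) (hj : j < h) :
    ⊥ ∉ A.map (up j) := by
  intro hb
  obtain ⟨s, hs, hb⟩ := Multiset.mem_map.1 hb
  rw [up_eq_bot, hA s hs] at hb
  lia

lemma exists_rsMatch_eq {A : Multiset T} (hA : A ≠ 0) (r : T) :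
    ∃ v, IsGreatest {v : T | v ≤ r ∧ Live T A v} v ∧ rsMatch T A r = descend T A v := by
  classical
  obtain ⟨a, ha⟩ := Multiset.exists_mem_of_ne_zero hA
  have hex : ∃ v, IsGreatest {v : T | v ≤ r ∧ Live T A v} v := by
    obtain ⟨v, -, hv⟩ := Finite.exists_le_maximal (p := fun v : T => v ≤ r ∧ Live T A v)
      (a := ⊥) (h := ⟨bot_le, a, ha, bot_le⟩)
    refine ⟨v, hv.1, fun w hw => ?_⟩
    rcases le_total_of_directed hv.1.1 hw.1 with h | h
    · exact h
    · exact hv.2 hw h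
  exact ⟨hex.choose, hex.choose_spec, by rw [rsMatch, dif_pos hex]⟩

lemma mem_of_mem_support_rsMatch {A : Multiset T} (hA : A ≠ 0) {r s : T}
    (hs : s ∈ (rsMatch T A r).support) : s ∈ A := by
  obtain ⟨v, hv, he⟩ := exists_rsMatch_eq hA r
  rw [he] at hs
  exact (mem_of_mem_support_descend hv.1.2 hs).2

open Classical in
lemma average_potential_erase_le {ι : Type*} (p : ι → ι) (B : Multiset ι) (l : List ι) (v : ι)
    (hv : (liveOver p B v).Nonempty) :
    (∑ w ∈ liveOver p B v, potential p (B.erase w) l) / (liveOver p B v).card ≤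
      potential p B l + ((harmonic (liveOver p B v).card : ℝ) - 1) := by
  have h := sum_potential_erase_le p B l v
  have hc : (0 : ℝ) < (liveOver p B v).card := by exact_mod_cast hv.card_pos
  rw [sum_range_harmonic, sum_sub_distrib, sum_const, nsmul_eq_mul] at h
  rw [div_le_iff₀ hc]
  linarith

open Classical in
/-- On average, a request raises the number of crossings plus the potential of level `j` only if it
crosses level `j + 1`, and then by at most `H_Δ`. -/
lemma expect_rsMatch_le {A : Multiset T} {h j Δ : ℕ} (hary : IsAry T Δ) (hA0 : A ≠ 0)
    (hA : ∀ s ∈ A, depth T s = h) (hj : j < h) {r : T} (hr : depth T r = h) (l : List T) :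
    expect (rsMatch T A r)
        (fun s => cross j r s + potential Order.pred ((A.erase s).map (up j)) l) ≤
      potential Order.pred (A.map (up j)) (up j r :: l) +
        harmonic Δ * expect (rsMatch T A r) (cross (j + 1) r) := by
  obtain ⟨v, ⟨⟨hvr, hlive⟩, hmax⟩, he⟩ := exists_rsMatch_eq hA0 r
  rw [he]
  set B := A.map (up j) with hB
  have herase : ∀ s ∈ (descend T A v).support, v ≤ s ∧ s ∈ A ∧
      (A.erase s).map (up j) = B.erase (up j s) := by
    intro s hs
    obtain ⟨h1, h2⟩ := mem_of_mem_support_descend hlive hs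
    exact ⟨h1, h2, Multiset.map_erase_of_mem _ _ h2⟩
  have hdr : depth T (up j r) + j = h := by
    rw [depth_up, hr]
    lia
  have hdr' : depth T (up (j + 1) r) + (j + 1) = h := by
    rw [depth_up, hr]
    lia
  have hne : ∀ v, depth T v + (j + 1) = h → Live T A v →
      (liveOver Order.pred B v).Nonempty := by
    rintro v hv ⟨a, ha, hva⟩
    rw [← liveChildren_eq hA hv]
    refine liveChildren_nonempty ha (hva.lt_of_ne fun he => ?_)
    have := hA a ha
    rw [← he] at this
    lia
  by_cases h1 : up j r ∈ B
  · -- the request is served inside the subtree of `up j r`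
    have hle : up j r ≤ v := hmax ⟨up_le _ _, (live_iff hA hdr).2 h1⟩
    have hrhs : 0 ≤ expect (descend T A v) (cross (j + 1) r) :=
      expect_nonneg fun s => cross_nonneg _ _ _
    rw [potential, if_pos h1]
    refine le_trans (le_of_eq ?_)
      (le_add_of_nonneg_right (mul_nonneg (harmonic_nonneg Δ) hrhs))
    rw [← expect_const (descend T A v) (potential _ _ _)]
    refine expect_congr fun s hs => ?_
    obtain ⟨h2, h3, h4⟩ := herase s hs
    have h5 : up j s = up j r := up_eq_of_le (hle.trans h2) (by rw [hA s h3, hdr])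
    rw [h4, h5, cross, if_pos h5.symm, zero_add]
  · rw [potential, if_neg h1, ← up_succ]
    have hle1 : expect (descend T A v)
        (fun s => cross j r s + potential Order.pred ((A.erase s).map (up j)) l) ≤
        1 + expect (descend T A v) (fun s => potential Order.pred (B.erase (up j s)) l) := by
      rw [← expect_const (descend T A v) (1 : ℝ), ← expect_add]
      refine expect_mono fun s hs => ?_
      rw [(herase s hs).2.2]
      exact add_le_add (cross_le_one _ _ _) le_rfl
    refine hle1.trans ?_
    by_cases h2 : Live T A (up (j + 1) r)
    · -- the request leaves the subtree of `up j r` but not that of its parent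
      have hveq : v = up (j + 1) r := by
        refine le_antisymm ?_ (hmax ⟨up_le _ _, h2⟩)
        obtain ⟨i, rfl⟩ := exists_up_eq hvr
        refine up_antitone r (Nat.succ_le_of_lt (lt_of_not_ge fun hij => h1 ?_))
        obtain ⟨a, ha, hva⟩ := hlive
        exact (live_iff hA hdr).1 ⟨a, ha, (up_antitone r hij).trans hva⟩
      have hrhs : 0 ≤ expect (descend T A v) (cross (j + 1) r) :=
        expect_nonneg fun s => cross_nonneg _ _ _
      have := average_potential_erase_le Order.pred B l _ (hne _ hdr' h2)
      rw [← expect_descend_eq hA hdr' h2 (fun w => potential Order.pred (B.erase w) l),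
        ← hveq] at this
      rw [← hveq]
      nlinarith [mul_nonneg (harmonic_nonneg Δ) hrhs]
    · -- the request crosses level `j + 1`
      have hcross : expect (descend T A v) (cross (j + 1) r) = 1 := by
        rw [← expect_const (descend T A v) (1 : ℝ)]
        refine expect_congr fun s hs => ?_
        rw [cross, if_neg]
        intro h3
        exact h2 ⟨s, (herase s hs).2.1, h3 ▸ up_le _ _⟩
      have hdv : depth T v + (j + 1) ≤ h := by
        obtain ⟨i, rfl⟩ := exists_up_eq hvr
        rw [depth_up, hr]
        have : j + 1 ≤ i := by
          by_contra hi
          obtain ⟨a, ha, hva⟩ := hlive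
          exact h2 ⟨a, ha, (up_antitone r (by lia : i ≤ j + 1)).trans hva⟩
        lia
      have := expect_descend_le hA hdv hlive (fun w => potential Order.pred (B.erase w) l)
        (potential Order.pred B l + ((harmonic Δ : ℝ) - 1)) fun v' hv' hl' => by
          refine (average_potential_erase_le Order.pred B l v' (hne v' hv' hl')).trans ?_
          have := harmonic_mono (card_liveOver_le hary (bot_notMem_map_up hA hj) v')
          simp only at this
          rw [← hB] at this
          linarith
      rw [hcross]
      have := harmonic_nonneg (liveOver Order.pred B (up (j + 1) r)).card
      linarith

end Match

/-! ### The whole run -/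

section Run

variable {T : RootedTree}

open Classical in
/-- The indicator of the leaves below the node `w` of level `j`. -/
noncomputable def hit (j : ℕ) (w v : T) : ℝ := if up j v = w then 1 else 0

open Classical in
lemma count_map_up (j : ℕ) {n : ℕ} (S : Fin n → T) (w : T) :
    ((((univ.val.map S).map (up j)).count w : ℕ) : ℝ) = ∑ t, hit j w (S t) := by
  rw [Multiset.map_map, Multiset.count_map, ← Finset.filter_val, Finset.card_val,
    Finset.card_filter]
  push_cast
  refine sum_congr rfl fun t _ => ?_
  simp only [hit, Function.comp_apply, eq_comm]

open Classical in
lemma count_ofFn_up (j : ℕ) {n : ℕ} (R : Fin n → T) (w : T) :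
    (((List.ofFn fun t => up j (R t)).count w : ℕ) : ℝ) = ∑ t, hit j w (R t) := by
  rw [← count_map_up, Multiset.map_map, ← Multiset.coe_count]
  congr 2
  simp [List.ofFn_eq_map, Finset.univ, Fintype.elems, Function.comp_def]

variable [Fintype T]

/-- The expected total of the costs `c r s` over the pairs matched by the algorithm. -/
noncomputable def runCost (c : T → T → ℝ) {n : ℕ} (A : Multiset T) (R : Fin n → T) : ℝ :=
  expect (rsRun T n A R) fun M => ∑ t, c (R t) (M t)

open Classical in
lemma runCost_succ (c : T → T → ℝ) {n : ℕ} (A : Multiset T) (R : Fin (n + 1) → T) :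
    runCost c A R = expect (rsMatch T A (R 0)) fun s =>
      c (R 0) s + runCost c (A.erase s) (Fin.tail R) := by
  rw [runCost, rsRun, expect_bind]
  refine expect_congr fun s _ => ?_
  rw [expect_map]
  simp only [Fin.sum_univ_succ, Fin.cons_zero, Fin.cons_succ]
  rw [expect_add, expect_const]
  rfl

open Classical in
/-- The expected number of crossings of level `j` is at most the potential of that level plus
`H_Δ` times the expected number of crossings of level `j + 1`. -/
lemma runCost_cross_le {h j Δ : ℕ} (hary : IsAry T Δ) (hj : j < h) {n : ℕ} (A : Multiset T)
    (hcard : A.card = n) (hA : ∀ s ∈ A, depth T s = h) (R : Fin n → T)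
    (hR : ∀ t, depth T (R t) = h) :
    runCost (cross j) A R ≤
      potential Order.pred (A.map (up j)) (List.ofFn fun t => up j (R t)) +
        harmonic Δ * runCost (cross (j + 1)) A R := by
  induction n generalizing A with
  | zero => simp [runCost, rsRun, expect_pure, potential]
  | succ n ih =>
    have hA0 : A ≠ 0 := by
      rintro rfl
      simp at hcard
    rw [runCost_succ, runCost_succ, List.ofFn_succ]
    set l := List.ofFn fun t : Fin n => up j (R t.succ) with hl
    have hstep := expect_rsMatch_le hary hA0 hA hj (hR 0) l
    have hih : expect (rsMatch T A (R 0))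
        (fun s => cross j (R 0) s + runCost (cross j) (A.erase s) (Fin.tail R)) ≤
        expect (rsMatch T A (R 0)) fun s =>
          (cross j (R 0) s + potential Order.pred ((A.erase s).map (up j)) l) +
            harmonic Δ * runCost (cross (j + 1)) (A.erase s) (Fin.tail R) := by
      refine expect_mono fun s hs => ?_
      have hsA := mem_of_mem_support_rsMatch hA0 hs
      have := ih (A.erase s) (by rw [Multiset.card_erase_of_mem hsA, hcard]; rfl)
        (fun a ha => hA a (Multiset.mem_of_mem_erase ha)) (Fin.tail R) fun t => hR t.succ
      change _ ≤ potential Order.pred ((A.erase s).map (up j)) l + _ at this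
      linarith
    rw [expect_add (rsMatch T A (R 0)) (fun s => cross j (R 0) s + _), expect_const_mul] at hih
    rw [expect_add (rsMatch T A (R 0)) (cross (j + 1) (R 0))]
    linarith

lemma runCost_mono {c c' : T → T → ℝ} {n h : ℕ} (A : Multiset T)
    (hcard : A.card = n) (hA : ∀ s ∈ A, depth T s = h) (R : Fin n → T)
    (hR : ∀ t, depth T (R t) = h)
    (hc : ∀ r s, depth T r = h → depth T s = h → c r s ≤ c' r s) :
    runCost c A R ≤ runCost c' A R := by
  classical
  induction n generalizing A with
  | zero => simp [runCost, rsRun, expect_pure]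
  | succ n ih =>
    have hA0 : A ≠ 0 := by
      rintro rfl
      simp at hcard
    rw [runCost_succ, runCost_succ]
    refine expect_mono fun s hs => ?_
    have hsA := mem_of_mem_support_rsMatch hA0 hs
    exact add_le_add (hc _ _ (hR 0) (hA s hsA))
      (ih (A.erase s) (by rw [Multiset.card_erase_of_mem hsA, hcard]; rfl)
        (fun a ha => hA a (Multiset.mem_of_mem_erase ha)) (Fin.tail R) fun t => hR t.succ)

lemma runCost_sum {I : Type*} (u : Finset I) (a : I → ℝ) (c : I → T → T → ℝ) {n : ℕ}
    (A : Multiset T) (R : Fin n → T) :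
    runCost (fun r s => ∑ i ∈ u, a i * c i r s) A R = ∑ i ∈ u, a i * runCost (c i) A R := by
  simp only [runCost, ← expect_const_mul, ← expect_sum]
  congr 1
  funext M
  rw [sum_comm]
  simp only [mul_sum]

lemma runCost_cross_height {h n : ℕ} (A : Multiset T)
    (hcard : A.card = n) (hA : ∀ s ∈ A, depth T s = h) (R : Fin n → T)
    (hR : ∀ t, depth T (R t) = h) : runCost (cross h) A R ≤ 0 := by
  refine (runCost_mono (c' := fun _ _ => 0) A hcard hA R hR fun r s hr hs => ?_).trans ?_
  · rw [cross, if_pos]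
    rw [up_eq_bot.2 hr.le, up_eq_bot.2 hs.le]
  · simp [runCost, expect_const]

/-- The total imbalance between requests and servers over the nodes of level `j`. -/
noncomputable def imbalance (h j : ℕ) {n : ℕ} (S R : Fin n → T) : ℝ :=
  ∑ w ∈ level T (h - j), |∑ t, hit j w (R t) - ∑ t, hit j w (S t)|

lemma runCost_cross_le_imbalance {h j Δ n : ℕ} (hary : IsAry T Δ) (hj : j < h) (S R : Fin n → T)
    (hS : ∀ t, depth T (S t) = h) (hR : ∀ t, depth T (R t) = h) :
    runCost (cross j) (univ.val.map S) R ≤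
      harmonic Δ * (imbalance h j S R + runCost (cross (j + 1)) (univ.val.map S) R) := by
  classical
  have hA : ∀ s ∈ univ.val.map S, depth T s = h := by
    intro s hs
    obtain ⟨t, -, rfl⟩ := Multiset.mem_map.1 hs
    exact hS t
  rw [mul_add]
  refine (runCost_cross_le hary hj (univ.val.map S) (by simp) hA R hR).trans
    (add_le_add ?_ le_rfl)
  refine (potential_le Order.pred (level T (h - j)) _ ?_ _
    (card_liveOver_le hary (bot_notMem_map_up hA hj))).trans ?_
  · intro w hw
    obtain ⟨t, rfl⟩ := (List.mem_ofFn' _ _).1 hw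
    rw [mem_level, depth_up, hR]
  · refine mul_le_mul_of_nonneg_left (sum_le_sum fun w _ => ?_) (harmonic_nonneg Δ)
    rw [← count_ofFn_up, ← count_map_up]
    rcases le_total ((List.ofFn fun t => up j (R t)).count w)
      (((univ.val.map S).map (up j)).count w) with hle | hle
    · rw [Nat.sub_eq_zero_of_le hle, Nat.cast_zero]
      exact abs_nonneg _
    · rw [Nat.cast_sub hle]
      exact le_abs_self _

lemma rsCost_le {len : T → ℝ} {α : ℝ} {h n : ℕ} (hα : 0 < α) (hT : IsHST T len α)
    (hnorm : IsNormalized T len) (S R : Fin n → T)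
    (hS : ∀ t, depth T (S t) = h) (hR : ∀ t, depth T (R t) = h) :
    rsCost T len S R ≤
      2 * ∑ j ∈ range h, 1 / α ^ (h - j - 1) * runCost (cross j) (univ.val.map S) R := by
  have hA : ∀ s ∈ univ.val.map S, depth T s = h := by
    intro s hs
    obtain ⟨t, -, rfl⟩ := Multiset.mem_map.1 hs
    exact hS t
  rw [mul_sum]
  simp only [← mul_assoc]
  rw [← runCost_sum (range h) (fun j => 2 * (1 / α ^ (h - j - 1))) cross]
  refine runCost_mono (univ.val.map S) (by simp) hA R hR fun r s hr hs => ?_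
  simp only [mul_assoc]
  rw [← mul_sum]
  exact treeDist_le hα hT hnorm hr hs

end Run

/-! ### Product distributions -/

section Product

variable {T : RootedTree} [Fintype T]

lemma prodExpect_add {n : ℕ} (D : Fin n → PMF T) (f g : (Fin n → T) → ℝ) :
    prodExpect T D (fun x => f x + g x) = prodExpect T D f + prodExpect T D g := by
  simp only [prodExpect, mul_add, sum_add_distrib]

lemma prodExpect_const_mul {n : ℕ} (D : Fin n → PMF T) (c : ℝ) (f : (Fin n → T) → ℝ) :
    prodExpect T D (fun x => c * f x) = c * prodExpect T D f := by
  simp only [prodExpect, mul_sum, mul_left_comm]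

lemma prodExpect_sum {I : Type*} {n : ℕ} (D : Fin n → PMF T) (s : Finset I)
    (f : I → (Fin n → T) → ℝ) :
    prodExpect T D (fun x => ∑ i ∈ s, f i x) = ∑ i ∈ s, prodExpect T D (f i) := by
  simp only [prodExpect, mul_sum]
  exact sum_comm

lemma prodExpect_mono {n : ℕ} {D : Fin n → PMF T} {f g : (Fin n → T) → ℝ}
    (h : ∀ x, (∀ i, x i ∈ (D i).support) → f x ≤ g x) :
    prodExpect T D f ≤ prodExpect T D g := by
  classical
  refine sum_le_sum fun x _ => ?_
  by_cases hx : ∀ i, x i ∈ (D i).support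
  · exact mul_le_mul_of_nonneg_left (h x hx) (prod_nonneg fun i _ => ENNReal.toReal_nonneg)
  · push Not at hx
    obtain ⟨i, hi⟩ := hx
    rw [prod_eq_zero (mem_univ i), zero_mul, zero_mul]
    rw [((D i).apply_eq_zero_iff _).2 hi, ENNReal.toReal_zero]

lemma prodExpect_succ {n : ℕ} (D : Fin (n + 1) → PMF T) (f : (Fin (n + 1) → T) → ℝ) :
    prodExpect T D f =
      expect (D 0) fun a => prodExpect T (Fin.tail D) fun x => f (Fin.cons a x) := by
  classical
  simp only [prodExpect, expect, mul_sum]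
  rw [← (Fin.consEquiv fun _ => (T : Type _)).sum_comp, Fintype.sum_prod_type]
  refine sum_congr rfl fun a _ => sum_congr rfl fun x _ => ?_
  rw [Fin.prod_univ_succ]
  exact mul_assoc _ _ _

lemma prodExpect_const {n : ℕ} (D : Fin n → PMF T) (c : ℝ) :
    prodExpect T D (fun _ => c) = c := by
  induction n with
  | zero => simp [prodExpect]
  | succ n ih => simp only [prodExpect_succ, ih, expect_const]

/-- The first two moments of a sum of independent centred variables. -/
lemma prodExpect_sum_sq {n : ℕ} (D : Fin n → PMF T) (g : Fin n → T → ℝ)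
    (hg : ∀ i, expect (D i) (g i) = 0) :
    prodExpect T D (fun x => ∑ i, g i (x i)) = 0 ∧
      prodExpect T D (fun x => (∑ i, g i (x i)) ^ 2) =
        ∑ i, expect (D i) (fun a => g i a ^ 2) := by
  induction n with
  | zero => simp [prodExpect]
  | succ n ih =>
    obtain ⟨h1, h2⟩ := ih (Fin.tail D) (fun i => g i.succ) fun i => hg i.succ
    simp only [prodExpect_succ, Fin.sum_univ_succ, Fin.cons_zero, Fin.cons_succ]
    constructor
    · simp only [prodExpect_add, prodExpect_const, h1, add_zero, hg]
    · simp only [add_sq, prodExpect_add, prodExpect_const, prodExpect_const_mul, h1, h2,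
        mul_zero, add_zero, expect_add, expect_const]
      rfl

/-- Two independent samples from a product distribution differ little in the number of coordinates
that hit a given set. -/
lemma prodExpect_sub_sq_le {n : ℕ} (D : Fin n → PMF T) (f : T → ℝ) (hf : ∀ a, f a ^ 2 = f a) :
    prodExpect T D (fun S => prodExpect T D fun R =>
      (∑ t, f (R t) - ∑ t, f (S t)) ^ 2) ≤ 2 * ∑ t, expect (D t) f := by
  set g : Fin n → T → ℝ := fun t a => f a - expect (D t) f with hgdef
  have hg : ∀ t, expect (D t) (g t) = 0 := by
    intro t
    simp only [hgdef, sub_eq_add_neg, expect_add, expect_const, add_neg_cancel]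
  obtain ⟨h1, h2⟩ := prodExpect_sum_sq D g hg
  have hdiff : ∀ S R : Fin n → T, (∑ t, f (R t) - ∑ t, f (S t)) ^ 2 =
      (∑ t, g t (R t)) ^ 2 + ((-2 * ∑ t, g t (S t)) * (∑ t, g t (R t)) +
        (∑ t, g t (S t)) ^ 2) := by
    intro S R
    simp only [hgdef, sum_sub_distrib]
    ring
  simp only [hdiff, prodExpect_add, prodExpect_const_mul, prodExpect_const, h1, h2, mul_zero,
    zero_add]
  rw [← two_mul]
  refine mul_le_mul_of_nonneg_left (sum_le_sum fun t _ => ?_) zero_le_two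
  have hexp : ∀ a, g t a ^ 2 = f a + ((-2 * expect (D t) f) * f a + expect (D t) f ^ 2) := by
    intro a
    simp only [hgdef]
    linear_combination hf a
  simp only [hexp, expect_add, expect_const_mul, expect_const]
  nlinarith [sq_nonneg (expect (D t) f)]

lemma expect_imbalance_le {n h j Δ : ℕ} (hary : IsAry T Δ) (D : Fin n → PMF T) :
    prodExpect T D (fun S => prodExpect T D fun R => imbalance h j S R) ≤
      3 / 2 * (√n * √((Δ : ℝ) ^ (h - j))) := by
  classical
  have hcard : ((level T (h - j)).card : ℝ) ≤ (Δ : ℝ) ^ (h - j) := by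
    exact_mod_cast card_level_le hary (h - j)
  rcases Nat.eq_zero_or_pos n with rfl | hn
  · simp [imbalance, prodExpect]
  rcases (by positivity : (0 : ℝ) ≤ (Δ : ℝ) ^ (h - j)).eq_or_lt with hN | hN
  · have h0 : level T (h - j) = ∅ := by
      rw [← hN] at hcard
      exact card_eq_zero.1 (by exact_mod_cast le_antisymm hcard (Nat.cast_nonneg _))
    simp only [imbalance, h0, sum_empty, prodExpect_const]
    positivity
  set N : ℝ := (Δ : ℝ) ^ (h - j) with hNdef
  have hn' : (0 : ℝ) < n := by exact_mod_cast hn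
  -- the value of `c` that balances the two terms of `2 * |z| ≤ z ^ 2 / c + c`
  set c : ℝ := √n / √N with hc
  have hcpos : 0 < c := by positivity
  have habs : ∀ z : ℝ, |z| ≤ 1 / (2 * c) * z ^ 2 + c / 2 := by
    intro z
    have : 0 ≤ (|z| - c) ^ 2 / (2 * c) := by positivity
    rw [← sq_abs z]
    have he : 1 / (2 * c) * |z| ^ 2 + c / 2 - |z| = (|z| - c) ^ 2 / (2 * c) := by
      field_simp
      ring
    linarith
  have hhit : ∀ w a : T, hit j w a ^ 2 = hit j w a := by
    intro w a
    rw [hit]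
    split_ifs <;> norm_num
  have hmono : prodExpect T D (fun S => prodExpect T D fun R => imbalance h j S R) ≤
      prodExpect T D (fun S => prodExpect T D fun R => ∑ w ∈ level T (h - j),
        (1 / (2 * c) * (∑ t, hit j w (R t) - ∑ t, hit j w (S t)) ^ 2 + c / 2)) :=
    prodExpect_mono fun S _ => prodExpect_mono fun R _ => sum_le_sum fun w _ => habs _
  simp only [prodExpect_sum, prodExpect_add, prodExpect_const_mul, prodExpect_const] at hmono
  have hsum : ∑ w ∈ level T (h - j), ∑ t, expect (D t) (hit j w) ≤ n := by
    rw [sum_comm]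
    refine (sum_le_card_nsmul _ _ 1 fun t _ => ?_).trans (by simp)
    rw [← expect_sum, ← expect_const (D t) 1]
    refine expect_mono fun a _ => ?_
    simp only [hit]
    rw [sum_ite_eq]
    split_ifs <;> norm_num
  refine hmono.trans ?_
  rw [sum_add_distrib, ← mul_sum, sum_const, nsmul_eq_mul]
  have hsq := sum_le_sum fun w (_ : w ∈ level T (h - j)) =>
    prodExpect_sub_sq_le D (hit j w) (hhit w)
  rw [← mul_sum] at hsq
  have h1 : 1 / (2 * c) * ∑ w ∈ level T (h - j), prodExpect T D (fun S => prodExpect T D fun R =>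
      (∑ t, hit j w (R t) - ∑ t, hit j w (S t)) ^ 2) ≤ 1 / (2 * c) * (2 * n) :=
    mul_le_mul_of_nonneg_left (by linarith) (by positivity)
  have h2 : ((level T (h - j)).card : ℝ) * (c / 2) ≤ N * (c / 2) :=
    mul_le_mul_of_nonneg_right hcard (by positivity)
  refine (add_le_add h1 h2).trans (le_of_eq ?_)
  have hsn : √(n : ℝ) ≠ 0 := by positivity
  have hsN : √N ≠ 0 := by positivity
  have e1 : (n : ℝ) = √n ^ 2 := (Real.sq_sqrt hn'.le).symm
  have e2 : N = √N ^ 2 := (Real.sq_sqrt hN.le).symm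
  have h3 : 1 / (2 * c) * (2 * n) = √n * √N := by
    rw [hc]
    field_simp
    exact e1
  have h4 : N * (c / 2) = √n * √N / 2 := by
    rw [hc]
    field_simp
    exact e2
  rw [h3, h4]
  ring

end Product

/-! ### Summing over the levels -/

/-- Solving the recursion between consecutive levels. -/
lemma sum_div_pow_le {α H : ℝ} (hα : 0 < α) (hH : 0 ≤ H) {h : ℕ} {a x : ℕ → ℝ}
    (ha : ∀ j < h, a j ≤ H * (x j + a (j + 1))) (hh : a h ≤ 0) :
    ∑ j ∈ range h, 1 / α ^ (h - j - 1) * a j ≤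
      H * ∑ j ∈ range h, x j / α ^ (h - j - 1) * ∑ l ∈ range (j + 1), (H / α) ^ l := by
  have key : ∀ m ≤ h, ∑ j ∈ range m, 1 / α ^ (h - j - 1) * a j ≤
      H * ∑ j ∈ range m, x j / α ^ (h - j - 1) * ∑ l ∈ range (j + 1), (H / α) ^ l +
        H * (∑ l ∈ range m, (H / α) ^ l) / α ^ (h - m) * a m := by
    intro m
    induction m with
    | zero => simp
    | succ m ih =>
      intro hm
      have h1 := ih (by lia)
      rw [sum_range_succ, sum_range_succ _ m]
      have hp : α ^ (h - m) = α ^ (h - m - 1) * α := by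
        rw [← pow_succ]
        congr 1
        lia
      have hs : h - (m + 1) = h - m - 1 := by lia
      set P := α ^ (h - m - 1) with hP
      have hPpos : 0 < P := by positivity
      set G := ∑ l ∈ range (m + 1), (H / α) ^ l with hG
      have hGnn : 0 ≤ G := sum_nonneg fun l _ => by positivity
      have hG' : G = H / α * ∑ l ∈ range m, (H / α) ^ l + 1 := geom_sum_succ
      have h2 : H * (∑ l ∈ range m, (H / α) ^ l) / α ^ (h - m) * a m + 1 / P * a m =
          G / P * a m := by
        rw [hG', hp]
        field_simp
      have h3 : G / P * a m ≤ G / P * (H * (x m + a (m + 1))) :=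
        mul_le_mul_of_nonneg_left (ha m (by lia)) (by positivity)
      have h4 : G / P * (H * (x m + a (m + 1))) =
          H * (x m / P * G) + H * G / P * a (m + 1) := by
        field_simp
      rw [hs]
      linarith
  have := key h le_rfl
  have hlast : H * (∑ l ∈ range h, (H / α) ^ l) / α ^ (h - h) * a h ≤ 0 :=
    mul_nonpos_of_nonneg_of_nonpos (div_nonneg (mul_nonneg hH (sum_nonneg fun l _ => by positivity))
      (by positivity)) hh
  linarith

end HST

open HST in
theorem mainTheorem2 (T : RootedTree) [Fintype T] (len : T → ℝ) (α : ℝ) (Δ h n : ℕ)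
    (hα : 2 ≤ α) (hT : HST.IsHST T len α) (hnorm : HST.IsNormalized T len)
    (hary : HST.IsAry T Δ) (hheight : HST.HasHeight T h)
    (D : Fin n → PMF T) (hD : ∀ i, ∀ v ∈ (D i).support, HST.IsLeaf T v) :
    HST.rsExpectedCost T len D ≤
      6 * (harmonic Δ : ℝ) * √(n : ℝ) *
        ∑ j ∈ Finset.range h, (√((Δ : ℝ) ^ (h - j)) / α ^ (h - j - 1) *
          ∑ l ∈ Finset.range (j + 1), ((harmonic Δ : ℝ) / α) ^ l) := by
  have hα0 : 0 < α := by linarith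
  have hH := harmonic_nonneg Δ
  have hdepth : ∀ S : Fin n → T, (∀ i, S i ∈ (D i).support) → ∀ i, depth T (S i) = h :=
    fun S hS i => hheight _ (hD i _ (hS i))
  set a : ℕ → ℝ := fun j => prodExpect T D fun S => prodExpect T D fun R =>
    runCost (cross j) (Finset.univ.val.map S) R with ha
  have hcost : rsExpectedCost T len D ≤
      2 * ∑ j ∈ Finset.range h, 1 / α ^ (h - j - 1) * a j := by
    refine (prodExpect_mono fun S hS => prodExpect_mono fun R hR =>
      rsCost_le hα0 hT hnorm S R (hdepth S hS) (hdepth R hR)).trans (le_of_eq ?_)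
    simp only [prodExpect_const_mul, prodExpect_sum, ha]
  have hrec : ∀ j < h, a j ≤
      harmonic Δ * (3 / 2 * (√n * √((Δ : ℝ) ^ (h - j))) + a (j + 1)) := by
    intro j hj
    refine (prodExpect_mono fun S hS => prodExpect_mono fun R hR =>
      runCost_cross_le_imbalance hary hj S R (hdepth S hS) (hdepth R hR)).trans ?_
    simp only [prodExpect_const_mul, prodExpect_add]
    exact mul_le_mul_of_nonneg_left (add_le_add (expect_imbalance_le hary D) le_rfl) hH
  have hlast : a h ≤ 0 := by
    refine (prodExpect_mono fun S hS => prodExpect_mono (g := fun _ => 0) fun R hR =>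
      runCost_cross_height _ (by simp) ?_ R (hdepth R hR)).trans ?_
    · intro s hs
      obtain ⟨t, -, rfl⟩ := Multiset.mem_map.1 hs
      exact hdepth S hS t
    · simp only [prodExpect_const, le_refl]
  have hsum := sum_div_pow_le hα0 hH hrec hlast
  have hfactor : ∑ j ∈ Finset.range h, 3 / 2 * (√n * √((Δ : ℝ) ^ (h - j))) / α ^ (h - j - 1) *
        ∑ l ∈ Finset.range (j + 1), ((harmonic Δ : ℝ) / α) ^ l =
      3 / 2 * √n * ∑ j ∈ Finset.range h, (√((Δ : ℝ) ^ (h - j)) / α ^ (h - j - 1) *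
        ∑ l ∈ Finset.range (j + 1), ((harmonic Δ : ℝ) / α) ^ l) := by
    rw [Finset.mul_sum]
    refine Finset.sum_congr rfl fun j _ => ?_
    ring
  rw [hfactor] at hsum
  set W := ∑ j ∈ Finset.range h, (√((Δ : ℝ) ^ (h - j)) / α ^ (h - j - 1) *
    ∑ l ∈ Finset.range (j + 1), ((harmonic Δ : ℝ) / α) ^ l) with hW
  have hW0 : 0 ≤ W := Finset.sum_nonneg fun j _ =>
    mul_nonneg (by positivity) (Finset.sum_nonneg fun l _ => pow_nonneg (div_nonneg hH hα0.le) _)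
  have hnn : 0 ≤ (harmonic Δ : ℝ) * √n * W := mul_nonneg (mul_nonneg hH (by positivity)) hW0
  linarith
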